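/- Let $n\ge 4$. A convex body in $\mathbb R^n$ is a compact convex set with non-empty interior, a polytope is the convex hull of finitely many points, and $K|H$ is the orthogonal projection of $K$ onto a linear subspace $H$. A set $D\subset H$ has a rigid motion symmetry if $\varphi(D)=D+a$ for some $a\in H$ and some orthogonal transformation $\varphi\neq\mathrm{id}$ of $H$. For $\dim H=3$ and a unit vector $\xi\in H$, $D$ has a $(\xi,\pi)$-symmetry if $\varphi(D)=D+a$ for some $a\in H$, where $\varphi$ is the rotation of $H$ by the angle $\pi$ about the axis $\mathbb R\xi$. Sets $D,D'\subset H$ are directly congruent if $\varphi(D)=D'+a$ for some $a\in H$ and $\varphi\in SO(H)$. The width of $K$ in a direction $\theta\in S^{n-1}$ is $\omega_K(\theta)=h_K(\theta)+h_K(-\theta)$, where $h_K(x)=\max_{y\in K}x\cdot y$. A diameter of $K$ is a segment contained in $K$ of length $\max_{S^{n-1}}\omega_K$, and $K$ has countably many diameters if $\omega_K$ attains its maximum over $S^{n-1}$ on a countable set. For convex bodies $K,L$ and $\zeta\in S^{n-1}$ consider the following two sets of hypotheses; they are the hypotheses of a uniqueness result for convex bodies with directly congruent projections (under (S) and (G),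 that result asserts that $K$ is a translate of $L$; it is not part of the present statement). (S) $K$ and $L$ have countably many diameters; $K$ has a diameter parallel to $\zeta$; and for every $3$-dimensional subspace $H\ni\zeta$, the side projections $K|H$ and $L|H$ are directly congruent and have no $(\zeta,\pi)$-symmetry and no $(u,\pi)$-symmetry for any unit vector $u\in H\cap\zeta^\perp$. (G) For every $3$-dimensional subspace $G\subset\zeta^\perp$, the ground projections $K|G$ and $L|G$ are directly congruent and have no rigid motion symmetry. Call a convex body $K$ covered if it has countably many diameters and has a diameter parallel to some $\zeta\in S^{n-1}$ such that the side projections $K|H$ have no $(\zeta,\pi)$- and no $(u,\pi)$-symmetries as in (S), and the ground projections $K|G$ have no rigid motion symmetries as in (G). Then: 1. For every convex body $K$ in $\mathbb R^n$ and every $\varepsilon>0$ there is a polytope $P$ with non-empty interior, at Hausdorff distance less than $\varepsilon$ from $K$, such that for no $3$-dimensional subspace $H$ of $\mathbb R^n$ does $P|H$ have a rigid motion symmetry. 2. Every polytope $P$ with non-empty interior none of whose $3$-dimensional projections has a rigid motion symmetry is covered. Moreover, if $P$ has a diameter parallel to $\zeta$, and $L$ is a convex body with countably many diameters such that $P|H$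 and $L|H$ are directly congruent for all $3$-dimensional $H\ni\zeta$, then $(P,L,\zeta)$ satisfies (S); if also $P|G$ and $L|G$ are directly congruent for all $3$-dimensional $G\subset\zeta^\perp$, then $(P,L,\zeta)$ satisfies (G). 3. Consequently, the set of covered convex bodies contains a set of polytopes that is dense, in the Hausdorff metric, in the set of all convex bodies in $\mathbb R^n$. -/

import Mathlib

/-- The `k`-dimensional projection `K|H`: the orthogonal projection of `K` onto the subspace `H`,
as a subset of the inner product space `H`. -/
def projOnto {n : ℕ} (K : Set (EuclideanSpace ℝ (Fin n)))
    (H : Submodule ℝ (EuclideanSpace ℝ (Fin n))) : Set H :=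
  (fun x => H.orthogonalProjectionOnto x) '' K

/-- `D` has a rigid motion symmetry: `φ(D) = D + a` for some non-identical orthogonal
transformation `φ` and some vector `a` of the ambient space. -/
def HasRigidMotionSymmetry {V : Type*} [NormedAddCommGroup V] [InnerProductSpace ℝ V]
    (D : Set V) : Prop :=
  ∃ (φ : V ≃ₗᵢ[ℝ] V) (a : V), φ ≠ LinearIsometryEquiv.refl ℝ V ∧ φ '' D = (fun x => x + a) '' D

/-- `φ` belongs to the special orthogonal group of `V`. -/
def IsRotation {V : Type*} [NormedAddCommGroup V] [InnerProductSpace ℝ V]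
    (φ : V ≃ₗᵢ[ℝ] V) : Prop :=
  LinearMap.det (φ.toLinearEquiv : V →ₗ[ℝ] V) = 1

/-- `D` and `D'` are directly congruent: some rotation takes `D` to a translate of `D'`. -/
def DirectlyCongruent {V : Type*} [NormedAddCommGroup V] [InnerProductSpace ℝ V]
    (D D' : Set V) : Prop :=
  ∃ (φ : V ≃ₗᵢ[ℝ] V) (a : V), IsRotation φ ∧ φ '' D = (fun x => x + a) '' D'

/-- `D` has a `(ξ, π)`-symmetry (for `V` of dimension three and `ξ` a unit vector): `φ(D) = D + a`
for some vector `a` and the rotation `φ` by the angle `π` fixing `ξ`, that is, acting as `-1` on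
the plane orthogonal to `ξ`. -/
def HasPiSymmetry {V : Type*} [NormedAddCommGroup V] [InnerProductSpace ℝ V]
    (ξ : V) (D : Set V) : Prop :=
  ∃ (φ : V ≃ₗᵢ[ℝ] V) (a : V), IsRotation φ ∧ φ ξ = ξ ∧ (∀ v, inner ℝ ξ v = 0 → φ v = -v) ∧
    φ '' D = (fun x => x + a) '' D

/-- No three-dimensional projection of `K` has a rigid motion symmetry. -/
def NoSymmetricProjections {n : ℕ} (K : Set (EuclideanSpace ℝ (Fin n))) : Prop :=
  ∀ H : Submodule ℝ (EuclideanSpace ℝ (Fin n)), Module.finrank ℝ H = 3 →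
    ¬ HasRigidMotionSymmetry (projOnto K H)

/-- A polytope: the convex hull of a finite set. -/
def IsPolytope {n : ℕ} (K : Set (EuclideanSpace ℝ (Fin n))) : Prop :=
  ∃ s : Finset (EuclideanSpace ℝ (Fin n)), K = convexHull ℝ (s : Set (EuclideanSpace ℝ (Fin n)))

/-- Convex bodies of `ℝⁿ` with non-empty interior, with the Hausdorff metric that Mathlib puts on
`ConvexBody` (whose members are the non-empty compact convex sets). -/
abbrev SolidBody (n : ℕ) : Type :=
  {K : ConvexBody (EuclideanSpace ℝ (Fin n)) //
    (interior (K : Set (EuclideanSpace ℝ (Fin n)))).Nonempty}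

/-- The underlying set of a convex body. -/
abbrev SolidBody.set {n : ℕ} (K : SolidBody n) : Set (EuclideanSpace ℝ (Fin n)) := K.1

/-- The support function `h_K(x) = max {⟨x, y⟩ : y ∈ K}`. -/
noncomputable def supportFun {n : ℕ} (K : Set (EuclideanSpace ℝ (Fin n)))
    (x : EuclideanSpace ℝ (Fin n)) : ℝ :=
  sSup ((fun y => inner ℝ x y) '' K)

/-- The width function `ω_K(x) = h_K(x) + h_K(-x)`. -/
noncomputable def widthFun {n : ℕ} (K : Set (EuclideanSpace ℝ (Fin n)))
    (x : EuclideanSpace ℝ (Fin n)) : ℝ :=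
  supportFun K x + supportFun K (-x)

/-- `K` has countably many diameters: the width function attains its maximum over the unit sphere
on a countable set of directions. -/
def CountablyManyDiameters {n : ℕ} (K : Set (EuclideanSpace ℝ (Fin n))) : Prop :=
  {θ | θ ∈ Metric.sphere (0 : EuclideanSpace ℝ (Fin n)) 1 ∧
    IsMaxOn (widthFun K) (Metric.sphere 0 1) θ}.Countable

/-- `ζ` is a unit vector and `K` has a diameter parallel to `ζ`: a segment `[z, y] ⊆ K` in the
direction `ζ` whose length is the maximal width of `K`. -/
def HasDiameterParallel {n : ℕ} (K : Set (EuclideanSpace ℝ (Fin n)))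
    (ζ : EuclideanSpace ℝ (Fin n)) : Prop :=
  ‖ζ‖ = 1 ∧ ∃ z y : EuclideanSpace ℝ (Fin n), segment ℝ z y ⊆ K ∧ y - z = ‖y - z‖ • ζ ∧
    IsGreatest (widthFun K '' Metric.sphere 0 1) ‖y - z‖

/-- The side projections of `K` and `L` (onto the three-dimensional subspaces containing `ζ`) are
directly congruent. -/
def SideCongruent {n : ℕ} (K L : Set (EuclideanSpace ℝ (Fin n)))
    (ζ : EuclideanSpace ℝ (Fin n)) : Prop :=
  ∀ H : Submodule ℝ (EuclideanSpace ℝ (Fin n)), Module.finrank ℝ H = 3 → ζ ∈ H →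
    DirectlyCongruent (projOnto K H) (projOnto L H)

/-- The ground projections of `K` and `L` (onto the three-dimensional subspaces of `ζᗮ`) are
directly congruent. -/
def GroundCongruent {n : ℕ} (K L : Set (EuclideanSpace ℝ (Fin n)))
    (ζ : EuclideanSpace ℝ (Fin n)) : Prop :=
  ∀ G : Submodule ℝ (EuclideanSpace ℝ (Fin n)), Module.finrank ℝ G = 3 → G ≤ (ℝ ∙ ζ)ᗮ →
    DirectlyCongruent (projOnto K G) (projOnto L G)

/-- The side projections of `K` have no `(ζ, π)`-symmetries, and no `(u, π)`-symmetries for unit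
vectors `u` of the subspace that are orthogonal to `ζ`. -/
def SideAsymmetric {n : ℕ} (K : Set (EuclideanSpace ℝ (Fin n)))
    (ζ : EuclideanSpace ℝ (Fin n)) : Prop :=
  ∀ H : Submodule ℝ (EuclideanSpace ℝ (Fin n)), Module.finrank ℝ H = 3 → ∀ hζ : ζ ∈ H,
    ¬ HasPiSymmetry (⟨ζ, hζ⟩ : H) (projOnto K H) ∧
    ∀ u : H, ‖u‖ = 1 → inner ℝ ζ (u : EuclideanSpace ℝ (Fin n)) = 0 →
      ¬ HasPiSymmetry u (projOnto K H)

/-- The ground projections of `K` have no rigid motion symmetries. -/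
def GroundAsymmetric {n : ℕ} (K : Set (EuclideanSpace ℝ (Fin n)))
    (ζ : EuclideanSpace ℝ (Fin n)) : Prop :=
  ∀ G : Submodule ℝ (EuclideanSpace ℝ (Fin n)), Module.finrank ℝ G = 3 → G ≤ (ℝ ∙ ζ)ᗮ →
    ¬ HasRigidMotionSymmetry (projOnto K G)

/-- All hypotheses that the uniqueness result for directly congruent side projections puts on the
pair of convex bodies `K`, `L` and on the direction `ζ`. -/
structure SideHypotheses {n : ℕ} (K L : SolidBody n) (ζ : EuclideanSpace ℝ (Fin n)) : Prop where
  countable_left : CountablyManyDiameters K.set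
  countable_right : CountablyManyDiameters L.set
  diameter : HasDiameterParallel K.set ζ
  congruent : SideCongruent K.set L.set ζ
  asymmetric_left : SideAsymmetric K.set ζ
  asymmetric_right : SideAsymmetric L.set ζ

/-- The additional hypotheses on the ground projections. -/
structure GroundHypotheses {n : ℕ} (K L : SolidBody n) (ζ : EuclideanSpace ℝ (Fin n)) : Prop where
  congruent : GroundCongruent K.set L.set ζ
  asymmetric_left : GroundAsymmetric K.set ζ
  asymmetric_right : GroundAsymmetric L.set ζ

/-- The convex bodies `K` covered by the uniqueness result, i.e. those that satisfy every
hypothesis which concerns `K` alone, for one of their diameters. -/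
def IsCovered {n : ℕ} (K : SolidBody n) : Prop :=
  CountablyManyDiameters K.set ∧ ∃ ζ : EuclideanSpace ℝ (Fin n),
    HasDiameterParallel K.set ζ ∧ SideAsymmetric K.set ζ ∧ GroundAsymmetric K.set ζ

/-!
A polytope close to the parallel body `K + δB` inherits its lack of sharp corners, up to a small
angle, and so does each of its projections. Hence finitely many fixed directions in a plane have
distinct support points, so that a projection of dimension at least two has many extreme points
outside any given hyperplane. The points fixed by `q ↦ φ⁻¹ (q + a)` with `φ ≠ id` lie in a
hyperplane. A rigid motion symmetry of the projection onto `H` thus moves many vertices and yields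
`dim (E × E) + 1` disjoint pairs `(x, y)` of vertices, `E` being the ambient space, which satisfy
the affine relations `⟪w, x⟫ - ⟪φ⁻¹ w, y⟫ = -⟪w, a⟫` for all `w` in `H`. This is impossible when
the vertices are in general position, and a small perturbation puts them there.
-/

open Function Metric Module Set
open scoped InnerProductSpace

section NormalCones

variable {V : Type*} [NormedAddCommGroup V] [InnerProductSpace ℝ V] {D K : Set V} {κ : ℝ}

theorem inner_normalize_self (v : V) : ⟪v, NormedSpace.normalize v⟫_ℝ = ‖v‖ := by
  rcases eq_or_ne v 0 with rfl | hv
  · simp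
  · rw [NormedSpace.normalize, real_inner_smul_right, real_inner_self_eq_norm_mul_norm,
      inv_mul_cancel_left₀ (norm_ne_zero_iff.2 hv)]

theorem exists_mem_extremePoints_isMaxOn_inner (hD : IsCompact D) (hne : D.Nonempty) (v : V) :
    ∃ p ∈ D.extremePoints ℝ, IsMaxOn (inner ℝ v) D p := by
  have hface : IsExposed ℝ D ((innerSL ℝ v).toExposed D) :=
    ContinuousLinearMap.toExposed.isExposed
  obtain ⟨q, hq⟩ := hD.exists_isMaxOn hne (innerSL ℝ v).continuous.continuousOn
  obtain ⟨p, hp⟩ := (hface.isCompact hD).extremePoints_nonempty ⟨q, hq⟩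
  exact ⟨p, hface.isExtreme.extremePoints_subset_extremePoints hp, hp.1.2⟩

/-- Any two outer normals `a` and `b` of `D` at a common boundary point enclose a small angle:
`‖a + b‖` is at least `κ` times its largest possible value `‖a‖ + ‖b‖`. With `κ` close to `1` this
makes precise that the boundary of `D` has no sharp corners or ridges. -/
def HasThinNormalCones (D : Set V) (κ : ℝ) : Prop :=
  ∀ p ∈ D, ∀ a b : V, IsMaxOn (inner ℝ a) D p → IsMaxOn (inner ℝ b) D p →
    κ * (‖a‖ + ‖b‖) ≤ ‖a + b‖

theorem hasThinNormalCones_of_cthickening_subset {r R : ℝ} (hK : IsCompact K) (hr : 0 ≤ r)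
    (hR : 0 < R) (hκ : κ * R ≤ r) (hrD : cthickening r K ⊆ D) (hDR : D ⊆ cthickening R K) :
    HasThinNormalCones D κ := by
  intro p hp a b ha hb
  obtain ⟨k, hk, hkp⟩ : ∃ k ∈ K, ‖p - k‖ ≤ R := by
    simpa [hK.cthickening_eq_biUnion_closedBall hR.le, dist_eq_norm] using hDR hp
  have le_inner : ∀ v, IsMaxOn (inner ℝ v) D p → r * ‖v‖ ≤ ⟪v, p - k⟫_ℝ := by
    intro v hv
    rcases eq_or_ne v 0 with rfl | hv0
    · simp
    have hmem : k + r • NormedSpace.normalize v ∈ D :=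
      hrD (mem_cthickening_of_dist_le _ k _ _ hk (by
        simp [norm_smul, NormedSpace.norm_normalize hv0, abs_of_nonneg hr]))
    have hle : ⟪v, k + r • NormedSpace.normalize v⟫_ℝ ≤ ⟪v, p⟫_ℝ := hv hmem
    rw [inner_add_right, real_inner_smul_right, inner_normalize_self] at hle
    rw [inner_sub_right]
    linarith
  refine le_of_mul_le_mul_left ?_ hR
  calc R * (κ * (‖a‖ + ‖b‖)) = κ * R * (‖a‖ + ‖b‖) := by ring
    _ ≤ r * (‖a‖ + ‖b‖) := by gcongr
    _ ≤ ⟪a + b, p - k⟫_ℝ := by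
      rw [inner_add_left, mul_add]; exact add_le_add (le_inner a ha) (le_inner b hb)
    _ ≤ ‖a + b‖ * ‖p - k‖ := real_inner_le_norm _ _
    _ ≤ R * ‖a + b‖ := by rw [mul_comm]; gcongr

theorem HasThinNormalCones.image_orthogonalProjectionOnto (h : HasThinNormalCones D κ)
    (H : Submodule ℝ V) [H.HasOrthogonalProjection] :
    HasThinNormalCones (H.orthogonalProjectionOnto '' D) κ := by
  rintro _ ⟨p, hp, rfl⟩ a b ha hb
  have isMaxOn_lift : ∀ v : H, IsMaxOn (inner ℝ v) (H.orthogonalProjectionOnto '' D)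
      (H.orthogonalProjectionOnto p) → IsMaxOn (inner ℝ (v : V)) D p := fun v hv y hy => by
    simpa only [mem_ofPred_eq, Submodule.inner_orthogonalProjectionOnto_eq_of_mem_left] using
      hv (mem_image_of_mem _ hy)
  exact h p hp a b (isMaxOn_lift a ha) (isMaxOn_lift b hb)

theorem exists_norm_eq_one_inner_eq_zero (hV : 1 < finrank ℝ V) (w : V) :
    ∃ u : V, ‖u‖ = 1 ∧ ⟪w, u⟫_ℝ = 0 := by
  have := FiniteDimensional.of_finrank_pos (zero_lt_one.trans hV)
  have hne : (ℝ ∙ w)ᗮ ≠ ⊥ := fun hbot => by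
    have hle := finrank_span_le_card (R := ℝ) {w}
    rw [Submodule.orthogonal_eq_bot_iff.1 hbot, finrank_top, toFinset_singleton,
      Finset.card_singleton] at hle
    exact hle.not_gt hV
  obtain ⟨u, hu, hu0⟩ := Submodule.exists_mem_ne_zero_of_ne_bot hne
  refine ⟨NormedSpace.normalize u, NormedSpace.norm_normalize hu0, ?_⟩
  rw [NormedSpace.normalize, real_inner_smul_right,
    Submodule.mem_orthogonal_singleton_iff_inner_right.1 hu, mul_zero]

theorem exists_linearIsometry_complex_apply_I (hV : 1 < finrank ℝ V) {w : V} (hw : ‖w‖ = 1) :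
    ∃ f : ℂ →ₗᵢ[ℝ] V, f Complex.I = w := by
  obtain ⟨u, hu, hwu⟩ := exists_norm_eq_one_inner_eq_zero hV w
  have huw : Orthonormal ℝ ![u, w] := by simpa [hu, hw] using real_inner_comm w u ▸ hwu
  let b := Complex.orthonormalBasisOneI.toBasis
  have hb : b.constr ℝ ![u, w] ∘ b = ![u, w] := funext (b.constr_basis ℝ _)
  refine ⟨(b.constr ℝ ![u, w]).isometryOfOrthonormal (v := b) (by simp [b]) (hb.symm ▸ huw), ?_⟩
  simp [b]

theorem exists_lt_one_forall_norm_add_lt {E ι : Type*} [NormedAddCommGroup E] [NormedSpace ℝ E]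
    [StrictConvexSpace ℝ E] [Finite ι] {z : ι → E}
    (hz : Pairwise fun i j => ¬ SameRay ℝ (z i) (z j)) :
    ∃ κ : ℝ, 0 < κ ∧ κ < 1 ∧ Pairwise fun i j => ‖z i + z j‖ < κ * (‖z i‖ + ‖z j‖) := by
  have hev : ∀ᶠ κ : ℝ in nhdsWithin 1 (Iio 1), ∀ i j, i ≠ j →
      ‖z i + z j‖ < κ * (‖z i‖ + ‖z j‖) := by
    refine Filter.eventually_all.2 fun i => Filter.eventually_all.2 fun j =>
      Filter.eventually_imp_distrib_left.2 fun hij => ?_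
    have hlim : Filter.Tendsto (fun κ : ℝ => κ * (‖z i‖ + ‖z j‖)) (nhdsWithin 1 (Iio 1))
        (nhds (1 * (‖z i‖ + ‖z j‖))) :=
      ((continuous_mul_const _).tendsto _).mono_left nhdsWithin_le_nhds
    refine hlim.eventually_const_lt ?_
    rw [one_mul]
    exact norm_add_lt_of_not_sameRay (hz hij)
  obtain ⟨κ, hκ, hκ0, hκ1⟩ := (hev.and (Ioo_mem_nhdsLT zero_lt_one)).exists
  exact ⟨κ, hκ0, hκ1, hκ⟩

variable {ι : Type*} {z : ι → ℂ}

theorem HasThinNormalCones.exists_extremePoints_subsingleton_inner_eq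
    (h : HasThinNormalCones D κ) (hD : IsCompact D) (hne : D.Nonempty) (hV : 1 < finrank ℝ V)
    (hre : ∀ j, 0 < (z j).re) (hz : Pairwise fun i j => ‖z i + z j‖ < κ * (‖z i‖ + ‖z j‖))
    {w : V} (hw : ‖w‖ = 1) (c : ℝ) :
    ∃ p : ι → V, Injective p ∧ (∀ j, p j ∈ D.extremePoints ℝ) ∧
      {j | ⟪w, p j⟫_ℝ = c}.Subsingleton := by
  obtain ⟨f, hf⟩ := exists_linearIsometry_complex_apply_I hV hw
  choose p hp hmax using fun j => exists_mem_extremePoints_isMaxOn_inner hD hne (f (z j))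
  have eq_of_isMaxOn : ∀ i j, IsMaxOn (inner ℝ (f (z j))) D (p i) → i = j := by
    intro i j hij
    by_contra hne
    have hle := h (p i) (hp i).1 _ _ (hmax i) hij
    rw [← map_add, f.norm_map, f.norm_map, f.norm_map] at hle
    exact (hz hne).not_ge hle
  -- Support points `p i` and `p j` in the same hyperplane orthogonal to `w` also agree in the
  -- coordinate along `f 1`, since both directions have positive real part; so `p i` maximizes the
  -- direction of `p j` as well.
  refine ⟨p, fun i j hij => eq_of_isMaxOn i j (hij ▸ hmax j), hp, fun i hi j hj =>
    eq_of_isMaxOn i j ?_⟩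
  have inner_map : ∀ k q, ⟪f (z k), q⟫_ℝ = (z k).re * ⟪f 1, q⟫_ℝ + (z k).im * ⟪w, q⟫_ℝ := by
    intro k q
    rw [← hf, ← real_inner_smul_left, ← real_inner_smul_left, ← map_smul, ← map_smul,
      ← inner_add_left, ← map_add]
    simp [Complex.re_add_im]
  have inner_one_le : ∀ k l, ⟪w, p k⟫_ℝ = ⟪w, p l⟫_ℝ → ⟪f 1, p k⟫_ℝ ≤ ⟪f 1, p l⟫_ℝ := by
    intro k l hkl
    have hle : ⟪f (z l), p k⟫_ℝ ≤ ⟪f (z l), p l⟫_ℝ := hmax l (hp k).1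
    rw [inner_map, inner_map, hkl, add_le_add_iff_right] at hle
    exact le_of_mul_le_mul_left hle (hre l)
  have hwij : ⟪w, p i⟫_ℝ = ⟪w, p j⟫_ℝ := hi.trans hj.symm
  intro q hq
  have hle : ⟪f (z j), q⟫_ℝ ≤ ⟪f (z j), p j⟫_ℝ := hmax j hq
  rwa [inner_map j (p j), ← hwij, (inner_one_le j i hwij.symm).antisymm (inner_one_le i j hwij),
    ← inner_map] at hle

theorem HasThinNormalCones.exists_finset_extremePoints_inner_ne {M : ℕ} {z : Fin (M + 1) → ℂ}
    (h : HasThinNormalCones D κ) (hD : IsCompact D) (hne : D.Nonempty) (hV : 1 < finrank ℝ V)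
    (hre : ∀ j, 0 < (z j).re) (hz : Pairwise fun i j => ‖z i + z j‖ < κ * (‖z i‖ + ‖z j‖))
    {w : V} (hw : ‖w‖ = 1) (c : ℝ) :
    ∃ T : Finset V, T.card = M ∧ ∀ q ∈ T, q ∈ D.extremePoints ℝ ∧ ⟪w, q⟫_ℝ ≠ c := by
  obtain ⟨p, hinj, hp, hc⟩ :=
    h.exists_extremePoints_subsingleton_inner_eq hD hne hV hre hz hw c
  obtain ⟨j₀, hj₀⟩ : ∃ j₀, ∀ j ≠ j₀, ⟪w, p j⟫_ℝ ≠ c := by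
    rcases hc.eq_empty_or_singleton with hempty | ⟨j₀, hj₀⟩
    · exact ⟨0, fun j _ hj => (hempty.subset hj).elim⟩
    · exact ⟨j₀, fun j hj hjc => hj (hj₀.subset hjc)⟩
  refine ⟨Finset.univ.map ⟨p ∘ j₀.succAbove, hinj.comp j₀.succAbove_right_injective⟩, by simp, ?_⟩
  simp only [Finset.mem_map, Finset.mem_univ, true_and]
  rintro _ ⟨j, rfl⟩
  exact ⟨hp _, hj₀ _ (j₀.succAbove_ne j)⟩

end NormalCones

section RigidMotions

theorem exists_subset_card_disjoint_image {α : Type*} {f : α → α} (hf : Injective f) {k : ℕ}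
    {T : Finset α} (hT : ∀ p ∈ T, f p ≠ p) (hk : 3 * k ≤ T.card) :
    ∃ S ⊆ T, S.card = k ∧ ∀ p ∈ S, f p ∉ S := by
  classical
  induction k with
  | zero => exact ⟨∅, by simp, by simp, by simp⟩
  | succ k ih =>
    obtain ⟨S, hST, hS, hfS⟩ := ih (by omega)
    have hlt : (S ∪ S.image f ∪ S.preimage f hf.injOn).card < T.card := by
      have hunion₁ := Finset.card_union_le (S ∪ S.image f) (S.preimage f hf.injOn)
      have hunion₂ := Finset.card_union_le S (S.image f)
      have himage : (S.image f).card ≤ S.card := Finset.card_image_le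
      have hpreimage : (S.preimage f hf.injOn).card ≤ S.card :=
        Finset.card_le_card_of_injOn f (fun _ ha => Finset.mem_preimage.1 ha) hf.injOn
      omega
    obtain ⟨p, hpT, hp⟩ := Finset.exists_mem_notMem_of_card_lt_card hlt
    simp only [Finset.mem_union, Finset.mem_image, Finset.mem_preimage, not_or, not_exists,
      not_and] at hp
    obtain ⟨⟨hpS, hp_image⟩, hp_preimage⟩ := hp
    refine ⟨insert p S, Finset.insert_subset hpT hST, by rw [Finset.card_insert_of_notMem hpS, hS],
      fun q hq => ?_⟩
    rcases Finset.mem_insert.1 hq with rfl | hq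
    · simpa [hT q hpT] using hp_preimage
    · simpa [hfS q hq] using hp_image q hq

variable {V : Type*} [NormedAddCommGroup V] [InnerProductSpace ℝ V] {D D' : Set V}
  {φ : V ≃ₗᵢ[ℝ] V} {a : V}

theorem image_eq_image_add_iff :
    φ '' D = (fun x => x + a) '' D' ↔ ∀ x, x ∈ D ↔ φ x - a ∈ D' := by
  rw [Set.ext_iff, φ.surjective.forall]
  refine forall_congr' fun x => ?_
  rw [φ.injective.mem_set_image]
  simp [sub_eq_add_neg]

theorem symm_add_mem_extremePoints (hφ : φ '' D = (fun x => x + a) '' D) {q : V}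
    (hq : q ∈ D.extremePoints ℝ) : φ.symm (q + a) ∈ D.extremePoints ℝ := by
  rw [image_eq_image_add_iff] at hφ
  refine ⟨(hφ _).2 (by simpa using hq.1), fun y hy z hz ⟨s, t, hs, ht, hst, hyz⟩ => ?_⟩
  have hseg : s • (φ y - a) + t • (φ z - a) = q := by
    have hq' : φ (s • y + t • z) = q + a := by rw [hyz, φ.apply_symm_apply]
    rw [map_add, map_smul, map_smul] at hq'
    rw [smul_sub, smul_sub, sub_add_sub_comm, ← add_smul, hst, one_smul, hq', add_sub_cancel_right]
  have hyq : φ y - a = q := hq.2 ((hφ y).1 hy) ((hφ z).1 hz) ⟨s, t, hs, ht, hst, hseg⟩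
  rw [← hyq, sub_add_cancel, φ.symm_apply_apply]

theorem exists_inner_eq_of_map_eq_add (hφ : φ ≠ LinearIsometryEquiv.refl ℝ V) (a : V) :
    ∃ (w : V) (c : ℝ), ‖w‖ = 1 ∧ ∀ q, φ q = q + a → ⟪w, q⟫_ℝ = c := by
  obtain ⟨z, hz⟩ : ∃ z, φ z ≠ z := by
    by_contra! h
    exact hφ (LinearIsometryEquiv.ext h)
  have hw : φ.symm z - z ≠ 0 := fun h => hz <| by
    rw [← φ.symm.injective.eq_iff, φ.symm_apply_apply, sub_eq_zero.1 h]
  refine ⟨NormedSpace.normalize (φ.symm z - z), ‖φ.symm z - z‖⁻¹ * ⟪z, a⟫_ℝ,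
    NormedSpace.norm_normalize hw, fun q hq => ?_⟩
  -- The pairing of `φ q = q + a` with `z` reads `⟪φ⁻¹ z - z, q⟫ = ⟪z, a⟫`.
  have hadj : ⟪φ.symm z, q⟫_ℝ = ⟪z, φ q⟫_ℝ := by rw [← φ.inner_map_map, φ.apply_symm_apply]
  rw [NormedSpace.normalize, real_inner_smul_left, inner_sub_left, hadj, ← inner_sub_right, hq,
    add_sub_cancel_left]

theorem HasThinNormalCones.exists_finset_extremePoints_symm_add_notMem {κ : ℝ} {k : ℕ}
    {z : Fin (3 * k + 1) → ℂ} (h : HasThinNormalCones D κ) (hD : IsCompact D) (hne : D.Nonempty)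
    (hV : 1 < finrank ℝ V) (hre : ∀ j, 0 < (z j).re)
    (hz : Pairwise fun i j => ‖z i + z j‖ < κ * (‖z i‖ + ‖z j‖))
    (hφ : φ ≠ LinearIsometryEquiv.refl ℝ V) (a : V) :
    ∃ S : Finset V, S.card = k ∧ ∀ q ∈ S, q ∈ D.extremePoints ℝ ∧ φ.symm (q + a) ∉ S := by
  obtain ⟨w, c, hw, hfixed⟩ := exists_inner_eq_of_map_eq_add hφ a
  obtain ⟨T, hcard, hT⟩ := h.exists_finset_extremePoints_inner_ne hD hne hV hre hz hw c
  have hinj : Injective fun q => φ.symm (q + a) := φ.symm.injective.comp (add_left_injective a)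
  obtain ⟨S, hST, hS, hmoved⟩ := exists_subset_card_disjoint_image hinj
    (fun q hq hqa => (hT q hq).2 (hfixed q ((φ.symm_apply_eq).1 hqa).symm)) hcard.ge
  exact ⟨S, hS, fun q hq => ⟨(hT q (hST hq)).1, hmoved q hq⟩⟩

theorem HasPiSymmetry.hasRigidMotionSymmetry (hV : 1 < finrank ℝ V) {ξ : V}
    (h : HasPiSymmetry ξ D) : HasRigidMotionSymmetry D := by
  obtain ⟨φ, a, -, -, hneg, hφ⟩ := h
  refine ⟨φ, a, ?_, hφ⟩
  rintro rfl
  obtain ⟨u, hu, hξu⟩ := exists_norm_eq_one_inner_eq_zero hV ξ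
  have := IsAddTorsionFree.of_isTorsionFree ℝ V
  have hu0 : u = 0 := self_eq_neg.1 (hneg u hξu)
  simp [hu0] at hu

theorem DirectlyCongruent.hasRigidMotionSymmetry (h : DirectlyCongruent D D')
    (h' : HasRigidMotionSymmetry D') : HasRigidMotionSymmetry D := by
  obtain ⟨φ, b, -, hφ⟩ := h
  obtain ⟨ρ, a, hρ, hρa⟩ := h'
  rw [image_eq_image_add_iff] at hφ hρa
  refine ⟨(φ.trans ρ).trans φ.symm, φ.symm (ρ b + a - b), fun hrefl => hρ ?_, ?_⟩
  · ext x
    simpa using congrArg φ (DFunLike.congr_fun hrefl (φ.symm x))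
  · refine image_eq_image_add_iff.2 fun x => ?_
    have hshift : ρ (φ x - b) - a = ρ (φ x) - (ρ b + a - b) - b := by rw [map_sub]; abel
    rw [hφ x, hρa, hφ, hshift]
    simp

end RigidMotions

section GenericFamilies

theorem dense_setOf_linearIndependent {F ι : Type*} [NormedAddCommGroup F] [NormedSpace ℝ F]
    [FiniteDimensional ℝ F] [Fintype ι] (hι : Fintype.card ι ≤ finrank ℝ F) :
    Dense {y : ι → F | LinearIndependent ℝ y} := by
  intro y
  let B := finBasis ℝ F
  let e : ι ↪ Fin (finrank ℝ F) := (Fintype.equivFin ι).toEmbedding.trans (Fin.castLEEmb hι)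
  let T : End ℝ F := B.constr ℝ (extend e y 0)
  have hT : ∀ i, T (B (e i)) = y i := fun i => by
    rw [B.constr_basis, e.injective.extend_apply]
  -- `y - s • B = (T - s) B` is independent unless `s` is one of finitely many eigenvalues of `T`
  have hmaps : MapsTo (fun s : ℝ => y - s • (B ∘ e)) {s | T.HasEigenvalue s}ᶜ
      {y | LinearIndependent ℝ y} := by
    intro s hs
    rw [mem_compl_iff, mem_ofPred_eq, End.hasEigenvalue_iff, not_not, End.eigenspace_def] at hs
    have hli := (B.linearIndependent.comp e e.injective).map' _ hs
    rwa [show ⇑(T - s • 1) ∘ B ∘ e = y - s • (B ∘ e) by ext i; simp [hT]] at hli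
  have hzero : (0 : ℝ) ∈ closure {s | T.HasEigenvalue s}ᶜ :=
    T.finite_hasEigenvalue.countable.dense_compl ℝ 0
  simpa using map_mem_closure (by fun_prop) hzero hmaps

theorem dense_setOf_affineIndependent {F ι : Type*} [NormedAddCommGroup F] [NormedSpace ℝ F]
    [FiniteDimensional ℝ F] [Fintype ι] (hι : Fintype.card ι ≤ finrank ℝ F + 1) :
    Dense {y : ι → F | AffineIndependent ℝ y} := by
  classical
  rcases isEmpty_or_nonempty ι with hempty | ⟨⟨i₀⟩⟩
  · simp [affineIndependent_of_subsingleton]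
  let differences : (ι → F) →ₗ[ℝ] {i // i ≠ i₀} → F :=
    LinearMap.pi fun i => (LinearMap.proj i.1 : (ι → F) →ₗ[ℝ] F) - LinearMap.proj i₀
  have hsurj : Surjective differences := fun g =>
    ⟨fun i => if hi : i ≠ i₀ then g ⟨i, hi⟩ else 0, by ext i; simp [differences, i.2]⟩
  have hcard : Fintype.card {i // i ≠ i₀} ≤ finrank ℝ F := by
    rw [Fintype.card_subtype_compl, Fintype.card_subtype_eq]
    omega
  refine ((dense_setOf_linearIndependent hcard).preimage
    (differences.isOpenMap_of_finiteDimensional hsurj)).mono fun y hy => ?_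
  exact (affineIndependent_iff_linearIndependent_vsub ℝ y i₀).2 hy

/-- Any `dim (E × E) + 1` disjoint pairs of members of the family, viewed as points of `E × E`, are
affinely independent: the general position of vertices which excludes symmetric projections. -/
def IsGenericFamily {E I : Type*} [AddCommGroup E] [Module ℝ E] (x : I → E) : Prop :=
  ∀ σ : Fin (finrank ℝ (E × E) + 1) ⊕ Fin (finrank ℝ (E × E) + 1) ↪ I,
    AffineIndependent ℝ fun r => (x (σ (Sum.inl r)), x (σ (Sum.inr r)))

theorem dense_setOf_isGenericFamily (E I : Type*) [NormedAddCommGroup E] [NormedSpace ℝ E]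
    [FiniteDimensional ℝ E] [Finite I] : Dense {x : I → E | IsGenericFamily x} := by
  simp only [IsGenericFamily, ofPred_forall]
  refine dense_iInter_of_isOpen (fun σ => ?_) fun σ => ?_
  · exact isOpen_setOfPred_affineIndependent.preimage (by fun_prop)
  let pairs : (I → E) →ₗ[ℝ] Fin (finrank ℝ (E × E) + 1) → E × E :=
    LinearMap.pi fun r =>
      (LinearMap.proj (σ (Sum.inl r))).prod (LinearMap.proj (σ (Sum.inr r)))
  have hsurj : Surjective pairs := fun g =>
    ⟨extend σ (Sum.elim (fun r => (g r).1) fun r => (g r).2) 0, by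
      ext r <;> simp [pairs, σ.injective.extend_apply]⟩
  exact (dense_setOf_affineIndependent (by simp)).preimage
    (pairs.isOpenMap_of_finiteDimensional hsurj)

theorem IsGenericFamily.eq_zero_of_inner_add_inner_eq {E I : Type*} [NormedAddCommGroup E]
    [InnerProductSpace ℝ E] [FiniteDimensional ℝ E] {x : I → E} (hx : IsGenericFamily x)
    (σ : Fin (finrank ℝ (E × E) + 1) ⊕ Fin (finrank ℝ (E × E) + 1) ↪ I) {v t : E} {c : ℝ}
    (h : ∀ r, ⟪v, x (σ (Sum.inl r))⟫_ℝ + ⟪t, x (σ (Sum.inr r))⟫_ℝ = c) : v = 0 := by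
  let ℓ : E × E →ₗ[ℝ] ℝ := (innerₛₗ ℝ v).coprod (innerₛₗ ℝ t)
  have hspan : vectorSpan ℝ (range fun r => (x (σ (Sum.inl r)), x (σ (Sum.inr r)))) ≤
      LinearMap.ker ℓ := by
    refine Submodule.span_le.2 ?_
    rintro _ ⟨_, ⟨r, rfl⟩, _, ⟨s, rfl⟩, rfl⟩
    simpa [ℓ, inner_sub_right, sub_add_sub_comm] using sub_eq_zero.2 ((h r).trans (h s).symm)
  rw [(hx σ).vectorSpan_eq_top_of_card_eq_finrank_add_one (by simp)] at hspan
  simpa [ℓ] using hspan (Submodule.mem_top (x := (v, 0)))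

end GenericFamilies

section GenericPolytopes

theorem image_convexHull_range_extremePoints_subset {𝕜 E F I : Type*} [Field 𝕜] [LinearOrder 𝕜]
    [IsStrictOrderedRing 𝕜] [AddCommGroup E] [Module 𝕜 E] [AddCommGroup F] [Module 𝕜 F]
    (f : E →ₗ[𝕜] F) (x : I → E) :
    (f '' convexHull 𝕜 (range x)).extremePoints 𝕜 ⊆ range (f ∘ x) := by
  rw [LinearMap.image_convexHull, ← range_comp]
  exact extremePoints_convexHull_subset

variable {E I : Type*} [NormedAddCommGroup E] [InnerProductSpace ℝ E] [FiniteDimensional ℝ E]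
  [Finite I]

theorem IsGenericFamily.not_hasRigidMotionSymmetry_image_orthogonalProjectionOnto [Nonempty I]
    {x : I → E} (hx : IsGenericFamily x) {κ : ℝ}
    (hκ : HasThinNormalCones (convexHull ℝ (range x)) κ)
    {z : Fin (3 * (finrank ℝ (E × E) + 1) + 1) → ℂ} (hre : ∀ j, 0 < (z j).re)
    (hz : Pairwise fun i j => ‖z i + z j‖ < κ * (‖z i‖ + ‖z j‖)) {H : Submodule ℝ E}
    (hH : 1 < finrank ℝ H) :
    ¬ HasRigidMotionSymmetry (H.orthogonalProjectionOnto '' convexHull ℝ (range x)) := by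
  rintro ⟨φ, a, hφ, hφa⟩
  have hcompact : IsCompact (H.orthogonalProjectionOnto '' convexHull ℝ (range x)) :=
    ((finite_range x).isCompact_convexHull ℝ).image H.orthogonalProjectionOnto.continuous
  obtain ⟨S, hS, hext⟩ :=
    (hκ.image_orthogonalProjectionOnto H).exists_finset_extremePoints_symm_add_notMem hcompact
      ((range_nonempty x).convexHull.image _) hH hre hz hφ a
  let e : Fin (finrank ℝ (E × E) + 1) ≃ S := (S.equivFinOfCardEq hS).symm
  have exists_index := image_convexHull_range_extremePoints_subset
    H.orthogonalProjectionOnto.toLinearMap x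
  choose ι hι using fun r => exists_index (hext _ (e r).2).1
  choose τ hτ using fun r => exists_index (symm_add_mem_extremePoints hφa (hext _ (e r).2).1)
  simp only [comp_apply, ContinuousLinearMap.coe_coe] at hι hτ
  have hι_inj : Injective ι := fun r s hrs => e.injective (Subtype.ext (by rw [← hι, ← hι, hrs]))
  have hτ_inj : Injective τ := fun r s hrs => e.injective <| Subtype.ext <|
    add_left_injective a <| φ.symm.injective <| by simp only [← hτ, hrs]
  have hιτ : ∀ r s, ι r ≠ τ s := fun r s hrs =>
    (hext _ (e s).2).2 (by rw [← hτ, ← hrs, hι]; exact (e r).2)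
  have hzero : ∀ w : H, w = 0 := fun w => Subtype.ext <| by
    refine hx.eq_zero_of_inner_add_inner_eq (t := -(φ.symm w : H)) (c := -⟪w, a⟫_ℝ)
      ⟨Sum.elim ι τ, hι_inj.sumElim hτ_inj hιτ⟩ fun r => ?_
    have hadj : ⟪φ.symm w, φ.symm (e r + a)⟫_ℝ = ⟪w, (e r : H) + a⟫_ℝ := φ.symm.inner_map_map _ _
    simp only [Embedding.coeFn_mk, Sum.elim_inl, Sum.elim_inr, inner_neg_left]
    rw [← Submodule.inner_orthogonalProjectionOnto_eq_of_mem_left,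
      ← Submodule.inner_orthogonalProjectionOnto_eq_of_mem_left, hι, hτ, hadj, inner_add_right]
    ring
  have : Subsingleton H := ⟨fun v w => (hzero v).trans (hzero w).symm⟩
  simp [finrank_zero_of_subsingleton] at hH

end GenericPolytopes

section Approximation

variable {E : Type*} [NormedAddCommGroup E] [InnerProductSpace ℝ E]

theorem subset_of_cthickening_subset_cthickening [CompleteSpace E] {A P : Set E} {η : ℝ}
    (hη : 0 ≤ η) (hP : IsCompact P) (hconv : Convex ℝ P)
    (h : cthickening η A ⊆ cthickening η P) : A ⊆ P := by
  intro y hy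
  by_contra hyP
  obtain ⟨f, u, hf, hu⟩ := geometric_hahn_banach_closed_point hconv hP.isClosed hyP
  obtain ⟨v, rfl⟩ := (InnerProductSpace.toDual ℝ E).surjective f
  simp only [InnerProductSpace.toDual_apply_apply] at hf hu
  have hmem : y + η • NormedSpace.normalize v ∈ cthickening η A :=
    mem_cthickening_of_dist_le _ y _ _ hy <| by
      rcases eq_or_ne v 0 with rfl | hv
      · simpa using hη
      · simp [norm_smul, NormedSpace.norm_normalize hv, abs_of_nonneg hη]
  obtain ⟨q, hq, hdist⟩ : ∃ q ∈ P, ‖y + η • NormedSpace.normalize v - q‖ ≤ η := by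
    simpa [hP.cthickening_eq_biUnion_closedBall hη, dist_eq_norm] using h hmem
  have hle : ⟪v, y⟫_ℝ + η * ‖v‖ - ⟪v, q⟫_ℝ ≤ ‖v‖ * η := calc
    _ = ⟪v, y + η • NormedSpace.normalize v - q⟫_ℝ := by
      rw [inner_sub_right, inner_add_right, real_inner_smul_right, inner_normalize_self]
    _ ≤ ‖v‖ * η := (real_inner_le_norm _ _).trans (by gcongr)
  linarith [hf q hq]

theorem exists_isGenericFamily_cthickening_subset [FiniteDimensional ℝ E] {K : Set E}
    (hK : IsCompact K) {δ η : ℝ} (hδ : 0 ≤ δ) (hη : 0 < η) :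
    ∃ (t : Finset E) (x : t → E), IsGenericFamily x ∧
      cthickening δ K ⊆ cthickening η (range x) ∧ range x ⊆ cthickening (η + δ) K := by
  obtain ⟨t, htK, htf, hcover⟩ := (hK.cthickening (r := δ)).finite_cover_balls (half_pos hη)
  lift t to Finset E using htf
  obtain ⟨x, hx, hdist⟩ := (dense_setOf_isGenericFamily E t).exists_dist_lt
    (fun i : t => (i : E)) (half_pos hη)
  have hxi : ∀ i : t, dist (i : E) (x i) < η / 2 := fun i => (dist_le_pi_dist _ _ i).trans_lt hdist
  refine ⟨t, x, hx, fun y hy => ?_, ?_⟩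
  · obtain ⟨q, hq, hyq⟩ := mem_iUnion₂.1 (hcover hy)
    refine mem_cthickening_of_dist_le y (x ⟨q, hq⟩) _ _ (mem_range_self _) ?_
    linarith [dist_triangle y q (x ⟨q, hq⟩), mem_ball.1 hyq, hxi ⟨q, hq⟩]
  · rintro _ ⟨i, rfl⟩
    refine cthickening_cthickening_subset hη.le hδ K ?_
    refine mem_cthickening_of_dist_le _ (i : E) _ _ (htK i.2) ?_
    rw [dist_comm]
    exact ((hxi i).trans (half_lt_self hη)).le

theorem not_sameRay_of_re_eq {z w : ℂ} (hre : z.re = w.re) (hz : z.re ≠ 0) (hzw : z ≠ w) :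
    ¬ SameRay ℝ z w := by
  intro h
  obtain ⟨r, s, hr, -, hrs⟩ := h.exists_pos (by rintro rfl; simp at hz)
    (by rintro rfl; simp [hre] at hz)
  have hrs_re : r = s := by simpa [← hre, hz] using congrArg Complex.re hrs
  exact hzw (smul_right_injective ℂ hr.ne' (by simpa [hrs_re] using hrs))

theorem exists_finset_convexHull_not_hasRigidMotionSymmetry [FiniteDimensional ℝ E] {K : Set E}
    (hK : IsCompact K) (hconv : Convex ℝ K) (hne : K.Nonempty) {ε : ℝ} (hε : 0 < ε) :
    ∃ s : Finset E, K ⊆ interior (convexHull ℝ s) ∧ convexHull ℝ (s : Set E) ⊆ cthickening ε K ∧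
      ∀ H : Submodule ℝ E, 1 < finrank ℝ H →
        ¬ HasRigidMotionSymmetry (H.orthogonalProjectionOnto '' convexHull ℝ (s : Set E)) := by
  classical
  -- `κ` has to be fixed before the polytope and to serve every `H`: hence a fixed planar model
  let z : Fin (3 * (finrank ℝ (E × E) + 1) + 1) → ℂ := fun j => ⟨1, j⟩
  obtain ⟨κ, hκ0, hκ1, hz⟩ := exists_lt_one_forall_norm_add_lt (z := z) fun i j hij =>
    not_sameRay_of_re_eq rfl one_ne_zero (by simpa [z, Complex.ext_iff, Fin.val_inj] using hij)
  obtain ⟨δ, η, hη, hηδ, hsum, hratio⟩ :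
      ∃ δ η : ℝ, 0 < η ∧ η < δ ∧ η + δ ≤ ε ∧ κ * (η + δ) ≤ δ - η :=
    ⟨ε / 2, ε / 2 * (1 - κ) / 2, by nlinarith, by nlinarith, by nlinarith,
      by nlinarith [mul_nonneg hε.le (sq_nonneg (1 - κ))]⟩
  obtain ⟨t, x, hx, hcover, hrange⟩ :=
    exists_isGenericFamily_cthickening_subset hK (hη.trans hηδ).le hη
  have hinner : cthickening (δ - η) K ⊆ convexHull ℝ (range x) := by
    refine subset_of_cthickening_subset_cthickening hη.le
      ((finite_range x).isCompact_convexHull ℝ) (convex_convexHull ℝ _) ?_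
    rw [cthickening_cthickening hη.le (sub_nonneg.2 hηδ.le), add_sub_cancel]
    exact hcover.trans (cthickening_subset_of_subset _ (subset_convexHull ℝ _))
  have houter : convexHull ℝ (range x) ⊆ cthickening (η + δ) K :=
    convexHull_min hrange (hconv.cthickening _)
  have hthin : HasThinNormalCones (convexHull ℝ (range x)) κ :=
    hasThinNormalCones_of_cthickening_subset hK (sub_nonneg.2 hηδ.le) (by linarith) hratio
      hinner houter
  have : Nonempty t := by
    rw [← range_nonempty_iff_nonempty (f := x), ← convexHull_nonempty_iff (𝕜 := ℝ)]
    exact hne.mono ((self_subset_cthickening K).trans hinner)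
  refine ⟨Finset.univ.image x, ?_, ?_, fun H hH => ?_⟩ <;>
    rw [Finset.coe_image, Finset.coe_univ, image_univ]
  · exact (self_subset_thickening (sub_pos.2 hηδ) K).trans
      ((thickening_subset_interior_cthickening _ _).trans (interior_mono hinner))
  · exact houter.trans (cthickening_mono hsum K)
  · exact hx.not_hasRigidMotionSymmetry_image_orthogonalProjectionOnto hthin
      (fun _ => one_pos) hz hH

theorem exists_isPolytope_not_hasRigidMotionSymmetry {n : ℕ}
    (K : ConvexBody (EuclideanSpace ℝ (Fin n))) {ε : ℝ} (hε : 0 < ε) :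
    ∃ P : SolidBody n, IsPolytope P.set ∧
      (∀ H : Submodule ℝ (EuclideanSpace ℝ (Fin n)), 1 < finrank ℝ H →
        ¬ HasRigidMotionSymmetry (projOnto P.set H)) ∧
      hausdorffDist (K : Set (EuclideanSpace ℝ (Fin n))) P.set < ε := by
  obtain ⟨s, hKs, hsK, hsymm⟩ := exists_finset_convexHull_not_hasRigidMotionSymmetry K.isCompact
    K.convex K.nonempty (half_pos hε)
  refine ⟨⟨⟨convexHull ℝ s, convex_convexHull ℝ _, s.finite_toSet.isCompact_convexHull ℝ,
    K.nonempty.mono (hKs.trans interior_subset)⟩, K.nonempty.mono hKs⟩, ⟨s, rfl⟩, hsymm, ?_⟩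
  refine (hausdorffDist_le_of_mem_dist (half_pos hε).le
    (fun y hy => ⟨y, interior_subset (hKs hy), by simpa using (half_pos hε).le⟩)
    fun y hy => ?_).trans_lt (half_lt_self hε)
  simpa [K.isCompact.cthickening_eq_biUnion_closedBall (half_pos hε).le] using hsK hy

end Approximation

section Diameters

variable {n : ℕ} {K : Set (EuclideanSpace ℝ (Fin n))}

theorem exists_mem_extremePoints_supportFun_eq (hK : IsCompact K) (hne : K.Nonempty)
    (θ : EuclideanSpace ℝ (Fin n)) : ∃ p ∈ K.extremePoints ℝ, supportFun K θ = ⟪θ, p⟫_ℝ := by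
  obtain ⟨p, hp, hmax⟩ := exists_mem_extremePoints_isMaxOn_inner hK hne θ
  exact ⟨p, hp, IsGreatest.csSup_eq ⟨mem_image_of_mem _ hp.1, forall_mem_image.2 hmax⟩⟩

theorem inner_le_supportFun (hK : IsCompact K) {y : EuclideanSpace ℝ (Fin n)} (hy : y ∈ K)
    (θ : EuclideanSpace ℝ (Fin n)) : ⟪θ, y⟫_ℝ ≤ supportFun K θ :=
  le_csSup (hK.image (by fun_prop)).bddAbove (mem_image_of_mem _ hy)

theorem exists_mem_extremePoints_widthFun_eq (hK : IsCompact K) (hne : K.Nonempty)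
    (θ : EuclideanSpace ℝ (Fin n)) :
    ∃ y ∈ K.extremePoints ℝ, ∃ z ∈ K.extremePoints ℝ, widthFun K θ = ⟪θ, y - z⟫_ℝ := by
  obtain ⟨y, hy, hyθ⟩ := exists_mem_extremePoints_supportFun_eq hK hne θ
  obtain ⟨z, hz, hzθ⟩ := exists_mem_extremePoints_supportFun_eq hK hne (-θ)
  refine ⟨y, hy, z, hz, ?_⟩
  rw [widthFun, hyθ, hzθ, inner_neg_left, inner_sub_right, sub_eq_add_neg]

theorem dist_le_widthFun_normalize_sub (hK : IsCompact K) {y z : EuclideanSpace ℝ (Fin n)}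
    (hy : y ∈ K) (hz : z ∈ K) : dist y z ≤ widthFun K (NormedSpace.normalize (y - z)) := by
  have hyθ := inner_le_supportFun hK hy (NormedSpace.normalize (y - z))
  have hzθ := inner_le_supportFun hK hz (-NormedSpace.normalize (y - z))
  calc
    dist y z = ⟪NormedSpace.normalize (y - z), y - z⟫_ℝ := by
      rw [real_inner_comm, inner_normalize_self, dist_eq_norm]
    _ ≤ widthFun K (NormedSpace.normalize (y - z)) := by
      rw [inner_neg_left] at hzθ
      rw [inner_sub_right, widthFun]
      linarith

theorem widthFun_le_diam (hK : IsCompact K) (hne : K.Nonempty) {θ : EuclideanSpace ℝ (Fin n)}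
    (hθ : ‖θ‖ = 1) : widthFun K θ ≤ diam K := by
  obtain ⟨y, hy, z, hz, hyz⟩ := exists_mem_extremePoints_widthFun_eq hK hne θ
  calc
    widthFun K θ = ⟪θ, y - z⟫_ℝ := hyz
    _ ≤ ‖θ‖ * ‖y - z‖ := real_inner_le_norm θ (y - z)
    _ = dist y z := by rw [hθ, one_mul, dist_eq_norm]
    _ ≤ diam K := dist_le_diam_of_mem hK.isBounded hy.1 hz.1

theorem exists_ne_dist_eq_diam {X : Type*} [MetricSpace X] {s : Set X} (hs : IsCompact s)
    (hnt : s.Nontrivial) : ∃ y ∈ s, ∃ z ∈ s, y ≠ z ∧ dist y z = diam s := by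
  obtain ⟨⟨y, z⟩, ⟨hy, hz⟩, hmax⟩ := (hs.prod hs).exists_isMaxOn
    (hnt.nonempty.prod hnt.nonempty) continuous_dist.continuousOn
  have hdiam : dist y z = diam s := (dist_le_diam_of_mem hs.isBounded hy hz).antisymm
    (diam_le_of_forall_dist_le dist_nonneg fun p hp q hq => hmax (mk_mem_prod hp hq))
  exact ⟨y, hy, z, hz, dist_pos.1 (hdiam ▸ diam_pos hnt hs.isBounded), hdiam⟩

theorem isGreatest_widthFun_diam (hK : IsCompact K) (hnt : K.Nontrivial) :
    IsGreatest (widthFun K '' sphere 0 1) (diam K) := by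
  refine ⟨?_, forall_mem_image.2 fun θ hθ =>
    widthFun_le_diam hK hnt.nonempty (mem_sphere_zero_iff_norm.1 hθ)⟩
  obtain ⟨y, hy, z, hz, hne, hyz⟩ := exists_ne_dist_eq_diam hK hnt
  have hnorm := NormedSpace.norm_normalize (sub_ne_zero.2 hne)
  exact ⟨_, mem_sphere_zero_iff_norm.2 hnorm, (widthFun_le_diam hK hnt.nonempty hnorm).antisymm
    (hyz.ge.trans (dist_le_widthFun_normalize_sub hK hy hz))⟩

theorem exists_hasDiameterParallel (hK : IsCompact K) (hconv : Convex ℝ K) (hnt : K.Nontrivial) :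
    ∃ ζ, HasDiameterParallel K ζ := by
  obtain ⟨y, hy, z, hz, hne, hyz⟩ := exists_ne_dist_eq_diam hK hnt
  refine ⟨NormedSpace.normalize (y - z), NormedSpace.norm_normalize (sub_ne_zero.2 hne), z, y,
    hconv.segment_subset hz hy, (NormedSpace.norm_smul_normalize _).symm, ?_⟩
  rw [← dist_eq_norm, hyz]
  exact isGreatest_widthFun_diam hK hnt

theorem countablyManyDiameters_of_countable_extremePoints (hK : IsCompact K) (hnt : K.Nontrivial)
    (hext : (K.extremePoints ℝ).Countable) : CountablyManyDiameters K := by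
  refine ((hext.prod hext).image fun p => NormedSpace.normalize (p.1 - p.2)).mono ?_
  rintro θ ⟨hθ, hmax⟩
  rw [mem_sphere_zero_iff_norm] at hθ
  obtain ⟨y, hy, z, hz, hyz⟩ := exists_mem_extremePoints_widthFun_eq hK hnt.nonempty θ
  have hdiam : diam K ≤ ⟪θ, y - z⟫_ℝ := by
    obtain ⟨θ', hθ', hdiam'⟩ := (isGreatest_widthFun_diam hK hnt).1
    rw [← hyz, ← hdiam']
    exact hmax hθ'
  have hdist : ‖y - z‖ ≤ diam K := dist_eq_norm y z ▸ dist_le_diam_of_mem hK.isBounded hy.1 hz.1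
  have hinner : ⟪θ, y - z⟫_ℝ ≤ ‖y - z‖ := by simpa [hθ] using real_inner_le_norm θ (y - z)
  have hpos : 0 < ‖y - z‖ := (diam_pos hnt hK.isBounded).trans_le (hdiam.trans hinner)
  have hsmul : y - z = ‖y - z‖ • θ := by
    have hiff := inner_eq_norm_mul_iff_real (x := θ) (y := y - z)
    rw [hθ, one_mul, one_smul] at hiff
    exact (hiff.1 (hinner.antisymm (hdist.trans hdiam))).symm
  refine ⟨(y, z), ⟨hy, hz⟩, ?_⟩
  change NormedSpace.normalize (y - z) = θ
  rw [hsmul, NormedSpace.normalize_smul_of_pos hpos,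
    NormedSpace.normalize_eq_self_of_norm_eq_one hθ]

theorem IsPolytope.finite_extremePoints (hK : IsPolytope K) : (K.extremePoints ℝ).Finite := by
  obtain ⟨s, rfl⟩ := hK
  exact s.finite_toSet.subset extremePoints_convexHull_subset

theorem SolidBody.nontrivial [NeZero n] (K : SolidBody n) : K.set.Nontrivial :=
  (infinite_of_mem_nhds K.2.some (mem_interior_iff_mem_nhds.1 K.2.some_mem)).nontrivial

end Diameters

section Covered

variable {n : ℕ}

theorem NoSymmetricProjections.sideAsymmetric {K : Set (EuclideanSpace ℝ (Fin n))}
    (h : NoSymmetricProjections K) (ζ : EuclideanSpace ℝ (Fin n)) : SideAsymmetric K ζ :=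
  fun H hH _ =>
    have hH1 : 1 < finrank ℝ H := by omega
    ⟨fun hs => h H hH (hs.hasRigidMotionSymmetry hH1),
      fun _ _ _ hs => h H hH (hs.hasRigidMotionSymmetry hH1)⟩

theorem NoSymmetricProjections.groundAsymmetric {K : Set (EuclideanSpace ℝ (Fin n))}
    (h : NoSymmetricProjections K) (ζ : EuclideanSpace ℝ (Fin n)) : GroundAsymmetric K ζ :=
  fun G hG _ => h G hG

theorem SideCongruent.sideAsymmetric {K L : Set (EuclideanSpace ℝ (Fin n))}
    {ζ : EuclideanSpace ℝ (Fin n)} (h : SideCongruent K L ζ) (hK : NoSymmetricProjections K) :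
    SideAsymmetric L ζ := fun H hH hζ =>
  have hH1 : 1 < finrank ℝ H := by omega
  have hL : ¬ HasRigidMotionSymmetry (projOnto L H) := fun hs =>
    hK H hH ((h H hH hζ).hasRigidMotionSymmetry hs)
  ⟨fun hs => hL (hs.hasRigidMotionSymmetry hH1),
    fun _ _ _ hs => hL (hs.hasRigidMotionSymmetry hH1)⟩

theorem GroundCongruent.groundAsymmetric {K L : Set (EuclideanSpace ℝ (Fin n))}
    {ζ : EuclideanSpace ℝ (Fin n)} (h : GroundCongruent K L ζ) (hK : NoSymmetricProjections K) :
    GroundAsymmetric L ζ :=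
  fun G hG hGζ hs => hK G hG ((h G hG hGζ).hasRigidMotionSymmetry hs)

theorem SolidBody.countablyManyDiameters [NeZero n] (P : SolidBody n)
    (hext : (P.set.extremePoints ℝ).Countable) : CountablyManyDiameters P.set :=
  countablyManyDiameters_of_countable_extremePoints P.1.isCompact P.nontrivial hext

theorem isCovered_of_noSymmetricProjections [NeZero n] {P : SolidBody n}
    (hext : (P.set.extremePoints ℝ).Countable) (hP : NoSymmetricProjections P.set) :
    IsCovered P := by
  obtain ⟨ζ, hζ⟩ := exists_hasDiameterParallel P.1.isCompact P.1.convex P.nontrivial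
  exact ⟨P.countablyManyDiameters hext, ζ, hζ, hP.sideAsymmetric ζ, hP.groundAsymmetric ζ⟩

end Covered

theorem mainTheorem6_general (n : ℕ) [NeZero n] :
    (∀ K : ConvexBody (EuclideanSpace ℝ (Fin n)), ∀ ε : ℝ, 0 < ε → ∃ P : SolidBody n,
      IsPolytope P.set ∧
        (∀ H : Submodule ℝ (EuclideanSpace ℝ (Fin n)), 1 < finrank ℝ H →
          ¬ HasRigidMotionSymmetry (projOnto P.set H)) ∧
        hausdorffDist (K : Set (EuclideanSpace ℝ (Fin n))) P.set < ε) ∧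
    (∀ P : SolidBody n, (P.set.extremePoints ℝ).Countable → NoSymmetricProjections P.set →
      IsCovered P ∧
      ∀ ζ : EuclideanSpace ℝ (Fin n), HasDiameterParallel P.set ζ →
        ∀ L : SolidBody n, CountablyManyDiameters L.set → SideCongruent P.set L.set ζ →
          SideHypotheses P L ζ ∧ (GroundCongruent P.set L.set ζ → GroundHypotheses P L ζ)) ∧
    Dense {P : SolidBody n | IsPolytope P.set ∧ IsCovered P} := by
  refine ⟨fun K ε hε => exists_isPolytope_not_hasRigidMotionSymmetry K hε,
    fun P hext hP => ⟨isCovered_of_noSymmetricProjections hext hP, fun ζ hζ L hL hside => ⟨?_,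
      fun hground => ⟨hground, hP.groundAsymmetric ζ, hground.groundAsymmetric hP⟩⟩⟩,
    Metric.dense_iff.2 fun K ε hε => ?_⟩
  · exact ⟨P.countablyManyDiameters hext, hL, hζ, hside, hP.sideAsymmetric ζ,
      hside.sideAsymmetric hP⟩
  · obtain ⟨P, hpoly, hP, hdist⟩ := exists_isPolytope_not_hasRigidMotionSymmetry K.1 hε
    refine ⟨P, ?_, hpoly, isCovered_of_noSymmetricProjections
      hpoly.finite_extremePoints.countable fun H hH => hP H (by omega)⟩
    rwa [mem_ball, dist_comm, Subtype.dist_eq, ← ConvexBody.hausdorffDist_coe]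

theorem mainTheorem6 (n : ℕ) (hn : 4 ≤ n) :
    -- approximation by polytopes without symmetric three-dimensional projections
    (∀ K : SolidBody n, ∀ ε : ℝ, 0 < ε → ∃ P : SolidBody n,
      IsPolytope P.set ∧ NoSymmetricProjections P.set ∧
        Metric.hausdorffDist K.set P.set < ε) ∧
    -- all such polytopes are covered by the uniqueness result, with respect to each diameter
    (∀ P : SolidBody n, IsPolytope P.set → NoSymmetricProjections P.set →
      IsCovered P ∧
      ∀ ζ : EuclideanSpace ℝ (Fin n), HasDiameterParallel P.set ζ →
        ∀ L : SolidBody n, CountablyManyDiameters L.set → SideCongruent P.set L.set ζ →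
          SideHypotheses P L ζ ∧ (GroundCongruent P.set L.set ζ → GroundHypotheses P L ζ)) ∧
    -- the covered bodies include a dense set of polytopes
    Dense {P : SolidBody n | IsPolytope P.set ∧ IsCovered P} := by
  have : NeZero n := ⟨by omega⟩
  obtain ⟨happrox, hcov, hdense⟩ := mainTheorem6_general n
  refine ⟨fun K ε hε => ?_, fun P hP => hcov P hP.finite_extremePoints.countable, hdense⟩
  obtain ⟨P, hpoly, hP, hdist⟩ := happrox K.1 ε hε
  exact ⟨P, hpoly, fun H hH => hP H (by omega), hdist⟩
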